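/- Let $n \ge m \ge 3$ be integers. For a real $n\times m$ matrix $A$ with nonzero rows $a_1,\dots,a_n\in\mathbb{R}^m$ and $x\in\mathbb{R}^m\setminus\{0\}$, let $\theta_i(A,x)=\arccos\frac{a_i\cdot x}{\|a_i\|\,\|x\|}\in[0,\pi]$ be the angle between $a_i$ and $x$, let $\theta(A,x)=\min_{1\le i\le n}\theta_i(A,x)$ and $\theta(A)=\sup_{x\ne 0}\theta(A,x)$, and let the condition number of $A$ be $\mathscr{C}(A)=|\cos\theta(A)|^{-1}\in[1,+\infty]$ (with $0^{-1}=+\infty$). Let $A$ be a uniform random $n\times m$ matrix, that is, a random matrix whose rows are independent and each uniformly distributed on the unit sphere $S^{m-1}\subset\mathbb{R}^m$. Then $$\mathbf{E}\left[\mathscr{C}(A)^{\gamma}\right]=+\infty\quad\text{for every real }\gamma\ge 1,$$ and $$\mathbf{E}\left[\mathscr{C}(A)^{\gamma}\right]\le 1+\binom{n}{m}\,2\,m^{5/2}\,\frac{\gamma}{1-\gamma}\quad\text{for every }\gamma\in(0,1).$$ -/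

import Mathlib

open MeasureTheory ProbabilityTheory
open scoped ENNReal

namespace LinearConic

noncomputable section

/-- The `i`-th row of a real `n × m` matrix, as a vector of Euclidean space `ℝᵐ`. -/
def rowVec {n m : ℕ} (A : Matrix (Fin n) (Fin m) ℝ) (i : Fin n) : EuclideanSpace ℝ (Fin m) :=
  WithLp.toLp 2 (A i)

/-- `θ(A, x) = min_{1 ≤ i ≤ n} θ_i(A, x)`, where `θ_i(A, x) ∈ [0, π]` is the angle between the
`i`-th row of `A` and `x`. -/
def thetaAt {n m : ℕ} (A : Matrix (Fin n) (Fin m) ℝ) (x : EuclideanSpace ℝ (Fin m)) : ℝ :=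
  ⨅ i : Fin n, InnerProductGeometry.angle (rowVec A i) x

/-- `θ(A) = sup_{x ≠ 0} θ(A, x)`. -/
def theta {n m : ℕ} (A : Matrix (Fin n) (Fin m) ℝ) : ℝ :=
  ⨆ x : {x : EuclideanSpace ℝ (Fin m) // x ≠ 0}, thetaAt A x.1

/-- The condition number `𝒞(A) = 1 / |cos θ(A)|` of the system `A x ≤ 0`, `x ≠ 0`, with values in
`[0, ∞]`; it is `∞` if `cos θ(A) = 0`. -/
def condNumber {n m : ℕ} (A : Matrix (Fin n) (Fin m) ℝ) : ℝ≥0∞ :=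
  (ENNReal.ofReal |Real.cos (theta A)|)⁻¹

/-- The uniform probability distribution on the unit sphere of Euclidean space `ℝᵐ`: normalized
surface measure, regarded as a measure on `ℝᵐ`. -/
def uniformSphere (m : ℕ) : Measure (EuclideanSpace ℝ (Fin m)) :=
  (((volume : Measure (EuclideanSpace ℝ (Fin m))).toSphere Set.univ)⁻¹ •
    (volume : Measure (EuclideanSpace ℝ (Fin m))).toSphere).map Subtype.val

/-- A uniform random `n × m` matrix: its rows are independent random vectors, each of them
uniformly distributed on the unit sphere of `ℝᵐ`. -/
structure IsUniformRandomMatrix {Ω : Type*} [MeasurableSpace Ω] {n m : ℕ}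
    (A : Ω → Matrix (Fin n) (Fin m) ℝ) (P : Measure Ω) : Prop where
  hasLaw_row : ∀ i : Fin n, HasLaw (fun ω => rowVec (A ω) i) (uniformSphere m) P
  iIndepFun_row : iIndepFun (fun (i : Fin n) (ω : Ω) => rowVec (A ω) i) P

end

end LinearConic

/-! For unit rows, `cos θ(A)` equals `minMax`, the minimum over unit `x` of `max_i ⟪a i, x⟫`
(`cos_theta_eq_minMax`). Everything then concerns how often this number is near zero under the
product of the uniform measures.

Upper bound: if `|minMax| < ε`, the convex hull of the rows has a point of norm below `ε` on a
supporting hyperplane, so Carathéodory writes it with at most `m` rows. One weight is at least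
`1/m`; pairing with a normal `u` to the other rows leaves `|⟪a i, u⟫| < m ε`. Conditionally on the
other rows this is a spherical strip, of probability at most `2 √m · m ε`. A union bound over the
`m`-subsets and the choice of `i` gives a tail linear in `ε` (`pi_abs_minMax_lt_le`), which the
layer-cake formula integrates for `γ < 1`.

Divergence: for almost every sample some choice of signs of the rows makes `|minMax|` at most `|⟪a
0, u⟫|`, with `u` normal to `m - 1` other rows (`exists_signs_abs_minMax_le`). The law is invariant
under sign changes, so summing over the finitely many sign patterns bounds a multiple of the first
moment below by the integral of `1 / |⟪a 0, u⟫|`, which is infinite. Higher `γ` follow because the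
condition number is at least one. -/

namespace LinearConic

open Metric Set
open scoped RealInnerProductSpace Pointwise

/-! ### Deterministic geometry of the min-max value -/

section MinMax

variable {ι E : Type*} [Fintype ι] [Nonempty ι] [NormedAddCommGroup E] [InnerProductSpace ℝ E]

/-- The minimum over unit vectors `x` of `max_i ⟪a i, x⟫`. -/
noncomputable def minMax (a : ι → E) : ℝ := ⨅ x : sphere (0 : E) 1, ⨆ i, ⟪a i, (x : E)⟫

theorem continuous_iSup_inner (a : ι → E) : Continuous fun x : E => ⨆ i, ⟪a i, x⟫ := by
  have h : (fun x : E => ⨆ i, ⟪a i, x⟫)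
      = Finset.univ.sup' Finset.univ_nonempty fun i (x : E) => ⟪a i, x⟫ := by
    ext x
    rw [Finset.sup'_apply, Finset.sup'_univ_eq_ciSup]
  rw [h]
  exact Continuous.finset_sup' _ fun i _ => by fun_prop

theorem continuous_iSup_inner_left (x : E) : Continuous fun a : ι → E => ⨆ i, ⟪a i, x⟫ := by
  have h : (fun a : ι → E => ⨆ i, ⟪a i, x⟫)
      = Finset.univ.sup' Finset.univ_nonempty fun i (a : ι → E) => ⟪a i, x⟫ := by
    ext a
    rw [Finset.sup'_apply, Finset.sup'_univ_eq_ciSup]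
  rw [h]
  exact Continuous.finset_sup' _ fun i _ => by fun_prop

theorem bddBelow_range_iSup_inner (a : ι → E) :
    BddBelow (range fun x : sphere (0 : E) 1 => ⨆ i, ⟪a i, (x : E)⟫) := by
  refine ⟨-‖a (Classical.arbitrary ι)‖, ?_⟩
  rintro _ ⟨x, rfl⟩
  refine le_trans ?_ (le_ciSup (finite_range fun i => ⟪a i, (x : E)⟫).bddAbove
    (Classical.arbitrary ι))
  have h := abs_real_inner_le_norm (a (Classical.arbitrary ι)) (x : E)
  rw [norm_eq_of_mem_sphere x, mul_one] at h
  exact neg_le_of_abs_le h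

theorem minMax_le {a : ι → E} {x : E} {c : ℝ} (hx : ‖x‖ = 1) (h : ∀ i, ⟪a i, x⟫ ≤ c) :
    minMax a ≤ c :=
  (ciInf_le (bddBelow_range_iSup_inner a) ⟨x, by simpa using hx⟩).trans (ciSup_le h)

theorem exists_minMax_le_inner (a : ι → E) {x : E} (hx : ‖x‖ = 1) : ∃ i, minMax a ≤ ⟪a i, x⟫ := by
  obtain ⟨i, hi⟩ := exists_eq_ciSup_of_finite (f := fun i => ⟪a i, x⟫)
  exact ⟨i, (ciInf_le (bddBelow_range_iSup_inner a) ⟨x, by simpa using hx⟩).trans hi.ge⟩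

omit [Nonempty ι] in
theorem le_minMax [Nontrivial E] {a : ι → E} {c : ℝ} (h : ∀ x : E, ‖x‖ = 1 → ∃ i, c ≤ ⟪a i, x⟫) :
    c ≤ minMax a := by
  have : Nonempty (sphere (0 : E) 1) := (NormedSpace.sphere_nonempty.2 zero_le_one).to_subtype
  refine le_ciInf fun x => ?_
  obtain ⟨i, hi⟩ := h x (norm_eq_of_mem_sphere x)
  exact hi.trans (le_ciSup (finite_range fun i => ⟪a i, (x : E)⟫).bddAbove i)

theorem exists_inner_le_minMax [Nontrivial E] [FiniteDimensional ℝ E] (a : ι → E) :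
    ∃ x : E, ‖x‖ = 1 ∧ ∀ i, ⟪a i, x⟫ ≤ minMax a := by
  have : Nonempty (sphere (0 : E) 1) := (NormedSpace.sphere_nonempty.2 zero_le_one).to_subtype
  have : CompactSpace (sphere (0 : E) 1) := isCompact_iff_compactSpace.1 (isCompact_sphere _ _)
  obtain ⟨x, hx⟩ := ((continuous_iSup_inner a).comp
    (continuous_subtype_val (p := (· ∈ sphere (0 : E) 1)))).exists_forall_le_of_hasCompactSupport
      (HasCompactSupport.of_compactSpace _)
  refine ⟨x, norm_eq_of_mem_sphere x, fun i => ?_⟩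
  exact (le_ciSup (finite_range fun i => ⟪a i, (x : E)⟫).bddAbove i).trans (le_ciInf hx)

/-- The infimum is over uncountably many directions, but an infimum of continuous functions is upper
semicontinuous. -/
theorem measurable_minMax [FiniteDimensional ℝ E] [MeasurableSpace E] [BorelSpace E] :
    Measurable (minMax : (ι → E) → ℝ) := by
  refine UpperSemicontinuous.measurable (upperSemicontinuous_ciInf bddBelow_range_iSup_inner ?_)
  exact fun x => (continuous_iSup_inner_left (x : E)).upperSemicontinuous

/-- The minimizing direction supports the convex hull at a point of norm at most `|minMax a|`. -/
theorem exists_mem_convexHull_support [Nontrivial E] [FiniteDimensional ℝ E] (a : ι → E) :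
    ∃ p ∈ convexHull ℝ (range a), ∃ x : E, ‖x‖ = 1 ∧ ‖p‖ ≤ |minMax a| ∧
      ∀ i, ⟪a i, x⟫ ≤ ⟪p, x⟫ := by
  have hcomp : IsCompact (convexHull ℝ (range a)) := (finite_range a).isCompact_convexHull (𝕜 := ℝ)
  have hconv : Convex ℝ (convexHull ℝ (range a)) := convex_convexHull ℝ _
  have hmem : ∀ i, a i ∈ convexHull ℝ (range a) := fun i =>
    subset_convexHull ℝ _ (mem_range_self i)
  by_cases h0 : (0 : E) ∈ convexHull ℝ (range a)
  · obtain ⟨x, hx, hax⟩ := exists_inner_le_minMax a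
    have hpos : 0 ≤ minMax a := by
      refine le_minMax fun y hy => ?_
      by_contra! hlt
      have hsub : convexHull ℝ (range a) ⊆ {z | ⟪z, y⟫ < 0} := by
        refine convexHull_min (by rintro _ ⟨i, rfl⟩; exact hlt i) ?_
        exact convex_halfSpace_lt ((innerₗ E).flip y).isLinear 0
      simpa using hsub h0
    -- A functional `y` separating this point from the hull would have all `⟪a i, y⟫` below `minMax
    -- a * ‖y‖`, yet some row reaches that value.
    refine ⟨minMax a • x, ?_, x, hx, by simp [norm_smul, hx], fun i => ?_⟩
    · by_contra hnot
      obtain ⟨f, u, hfu, hf⟩ := geometric_hahn_banach_closed_point hconv hcomp.isClosed hnot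
      set y := (InnerProductSpace.toDual ℝ E).symm f with hy
      have hfy : ∀ z, f z = ⟪y, z⟫ := fun z => by
        rw [hy, InnerProductSpace.toDual_symm_apply]
      have hu : 0 < u := by simpa using hfu 0 h0
      have hy0 : y ≠ 0 := by
        intro h
        rw [hfy, h, inner_zero_left] at hf
        linarith
      have hyn : 0 < ‖y‖ := norm_pos_iff.2 hy0
      obtain ⟨i, hi⟩ := exists_minMax_le_inner a (x := ‖y‖⁻¹ • y) (by
        rw [norm_smul, norm_inv, norm_norm, inv_mul_cancel₀ hyn.ne'])
      rw [inner_smul_right, real_inner_comm, ← hfy] at hi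
      have h1 := hfu _ (hmem i)
      have h2 : f (minMax a • x) ≤ minMax a * ‖y‖ := by
        rw [hfy, inner_smul_right]
        have := real_inner_le_norm y x
        rw [hx, mul_one] at this
        exact mul_le_mul_of_nonneg_left this hpos
      rw [inv_mul_eq_div, le_div_iff₀ hyn] at hi
      linarith
    · rw [real_inner_smul_left, real_inner_self_eq_norm_sq, hx]
      simpa using hax i
  -- Here `p` is the hull point nearest to the origin, and `-p / ‖p‖` is a test direction showing
  -- `minMax a ≤ -‖p‖`.
  · obtain ⟨p, hp, hpn⟩ := exists_norm_eq_iInf_of_complete_convex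
      ⟨_, hmem (Classical.arbitrary ι)⟩ hcomp.isComplete hconv 0
    rw [norm_eq_iInf_iff_real_inner_le_zero hconv hp] at hpn
    have hp0 : p ≠ 0 := fun h => h0 (h ▸ hp)
    have hpp : 0 < ‖p‖ := norm_pos_iff.2 hp0
    have hx : ‖(-(‖p‖⁻¹ • p) : E)‖ = 1 := by
      rw [norm_neg, norm_smul, norm_inv, norm_norm, inv_mul_cancel₀ hpp.ne']
    have key : ∀ i, ‖p‖ ^ 2 ≤ ⟪a i, p⟫ := fun i => by
      have := hpn (a i) (hmem i)
      rw [zero_sub, inner_neg_left, inner_sub_right, real_inner_self_eq_norm_sq,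
        real_inner_comm] at this
      linarith
    have hle : ∀ i, ⟪a i, -(‖p‖⁻¹ • p)⟫ ≤ -‖p‖ := fun i => by
      rw [inner_neg_right, inner_smul_right, neg_le_neg_iff, inv_mul_eq_div, le_div_iff₀ hpp]
      nlinarith [key i]
    refine ⟨p, hp, -(‖p‖⁻¹ • p), hx, ?_, fun i => (hle i).trans (le_of_eq ?_)⟩
    · have := minMax_le hx hle
      rw [le_abs]
      right
      linarith
    · rw [inner_neg_right, inner_smul_right, real_inner_self_eq_norm_sq]
      field_simp

/-- Carathéodory inside a supporting hyperplane: it needs `dim E` points instead of `dim E + 1`. -/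
theorem exists_convexCombination_of_minMax [Nontrivial E] [FiniteDimensional ℝ E] (a : ι → E) :
    ∃ (κ : Type) (_ : Fintype κ) (f : κ → ι) (w : κ → ℝ), Function.Injective f ∧
      Fintype.card κ ≤ Module.finrank ℝ E ∧ (∀ k, 0 < w k) ∧ ∑ k, w k = 1 ∧
      ‖∑ k, w k • a (f k)‖ ≤ |minMax a| := by
  obtain ⟨p, hp, x, hx, hpn, hax⟩ := exists_mem_convexHull_support a
  obtain ⟨κ, _, z, w, hz, hind, hw, hw1, hwz⟩ := eq_pos_convex_span_of_mem_convexHull hp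
  have hz' : ∀ k, ∃ i, a i = z k := fun k => hz (mem_range_self k)
  choose f hf using hz'
  have hinj : Function.Injective f := fun k l hkl => hind.injective (by rw [← hf k, ← hf l, hkl])
  let e := (Fintype.equivFin κ).symm
  refine ⟨Fin (Fintype.card κ), inferInstance, f ∘ e, w ∘ e, hinj.comp e.injective, ?_,
    fun k => hw _, by rw [← hw1]; exact e.sum_comp w, ?_⟩
  -- The gaps to the supporting hyperplane are nonnegative and their positively weighted sum
  -- vanishes.
  · have hact : ∀ k, ⟪z k, x⟫ = ⟪p, x⟫ := by
      have hsum : ∑ k, w k * (⟪p, x⟫ - ⟪z k, x⟫) = 0 := by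
        simp_rw [mul_sub]
        rw [Finset.sum_sub_distrib, ← Finset.sum_mul, hw1, one_mul, ← hwz, sum_inner]
        simp [real_inner_smul_left]
      have hnn : ∀ k ∈ Finset.univ, 0 ≤ w k * (⟪p, x⟫ - ⟪z k, x⟫) := fun k _ =>
        mul_nonneg (hw k).le (sub_nonneg.2 (hf k ▸ hax (f k)))
      intro k
      have := (Finset.sum_eq_zero_iff_of_nonneg hnn).1 hsum k (Finset.mem_univ k)
      rcases mul_eq_zero.1 this with h | h
      · exact absurd h (hw k).ne'
      · linarith
    have hsub : vectorSpan ℝ (range z) ≤ (ℝ ∙ x)ᗮ := by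
      rw [vectorSpan_def, Submodule.span_le]
      rintro _ ⟨_, ⟨k, rfl⟩, _, ⟨l, rfl⟩, rfl⟩
      rw [SetLike.mem_coe, Submodule.mem_orthogonal_singleton_iff_inner_left]
      beta_reduce
      rw [vsub_eq_sub, inner_sub_left, hact, hact, sub_self]
    have hx0 : x ≠ 0 := by
      rintro rfl
      simp at hx
    have hfin : Module.finrank ℝ (ℝ ∙ x)ᗮ + 1 = Module.finrank ℝ E := by
      have := Submodule.finrank_add_finrank_orthogonal (ℝ ∙ x)
      rw [finrank_span_singleton hx0] at this
      omega
    have hcard : Fintype.card κ ≠ 0 := by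
      intro h
      have := Fintype.card_eq_zero_iff.1 h
      simp at hw1
    have h1 := hind.finrank_vectorSpan (n := Fintype.card κ - 1) (by omega)
    have h2 := Submodule.finrank_mono hsub
    simp only [Fintype.card_fin]
    omega
  · have : ∑ k, (w ∘ e) k • a ((f ∘ e) k) = p := by
      rw [← hwz, ← e.sum_comp]
      simp [hf]
    rw [this]
    exact hpn

/-- If `minMax a` is small, then one of the vectors is close to a hyperplane that contains
`dim E - 1` of the others. -/
theorem exists_abs_inner_lt_of_abs_minMax_lt [Nontrivial E] [FiniteDimensional ℝ E]
    (hcard : Module.finrank ℝ E ≤ Fintype.card ι) (a : ι → E) {ε : ℝ} (h : |minMax a| < ε) :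
    ∃ J ∈ Finset.powersetCard (Module.finrank ℝ E) (Finset.univ : Finset ι), ∃ i ∈ J,
      ∀ u : E, ‖u‖ = 1 → (∀ j ∈ J, j ≠ i → ⟪a j, u⟫ = 0) →
        |⟪a i, u⟫| < Module.finrank ℝ E * ε := by
  obtain ⟨κ, _, f, w, hf, hκ, hw, hw1, hp⟩ := exists_convexCombination_of_minMax a
  -- The combination may use fewer than `dim E` vectors; padding gives every event the same
  -- index-set size.
  obtain ⟨J, hJf, hJ⟩ := Finset.exists_superset_card_eq
    (s := Finset.univ.map ⟨f, hf⟩) (n := Module.finrank ℝ E) (by simpa using hκ) hcard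
  have hne : (Finset.univ : Finset κ).Nonempty := by
    by_contra hne
    rw [Finset.not_nonempty_iff_eq_empty] at hne
    simp [hne] at hw1
  have hm : 0 < (Module.finrank ℝ E : ℝ) := Nat.cast_pos.2 Module.finrank_pos
  obtain ⟨k, -, hk⟩ : ∃ k ∈ Finset.univ, (Module.finrank ℝ E : ℝ)⁻¹ ≤ w k := by
    refine Finset.exists_le_of_sum_le hne ?_
    rw [hw1, Finset.sum_const, nsmul_eq_mul, Finset.card_univ, ← div_eq_mul_inv, div_le_one hm]
    exact_mod_cast hκ
  have hJm : ∀ l, f l ∈ J := fun l => hJf (by simp)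
  refine ⟨J, by simpa using hJ, f k, hJm k, fun u hu huj => ?_⟩
  have hinner : ⟪∑ l, w l • a (f l), u⟫ = w k * ⟪a (f k), u⟫ := by
    rw [sum_inner, Finset.sum_eq_single k]
    · rw [real_inner_smul_left]
    · intro l _ hl
      rw [real_inner_smul_left, huj _ (hJm l) (hf.ne hl), mul_zero]
    · simp
  have h1 := abs_real_inner_le_norm (∑ l, w l • a (f l)) u
  rw [hinner, hu, mul_one, abs_mul, abs_of_pos (hw k)] at h1
  have h2 : (Module.finrank ℝ E : ℝ)⁻¹ * |⟪a (f k), u⟫| < ε :=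
    (mul_le_mul_of_nonneg_right hk (abs_nonneg _)).trans_lt (h1.trans_lt (hp.trans_lt h))
  rwa [inv_mul_eq_div, div_lt_iff₀ hm, mul_comm] at h2

/-- If `dim E` of the vectors are linearly independent and one of them is at distance `t` from the
hyperplane spanned by the others, then `|minMax| ≤ t` after suitable changes of signs. -/
theorem exists_signs_abs_minMax_le [Nontrivial E] [FiniteDimensional ℝ E] (a : ι → E)
    {J : Finset ι} (hJ : J.card = Module.finrank ℝ E)
    (hind : LinearIndependent ℝ fun j : J => a j) {i : ι} {u : E}
    (hu : ‖u‖ = 1) (huj : ∀ j ∈ J, j ≠ i → ⟪a j, u⟫ = 0) :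
    ∃ s : ι → ℤˣ, |minMax fun j => s j • a j| ≤ |⟪a i, u⟫| := by
  classical
  set t := ⟪a i, u⟫ with ht
  obtain ⟨b, hb⟩ : ∃ b : J → ℝ, ∑ j, b j • a j = u := by
    have htop := hind.span_eq_top_of_card_eq_finrank' (by simpa using hJ)
    have : u ∈ Submodule.span ℝ (range fun j : J => a j) := htop ▸ Submodule.mem_top
    exact (Submodule.mem_span_range_iff_exists_fun ℝ).1 this
  have huu : ⟪u, u⟫ = 1 := by rw [real_inner_self_eq_norm_sq, hu, one_pow]
  obtain ⟨hiJ, hbt⟩ : ∃ hi : i ∈ J, b ⟨i, hi⟩ * t = 1 := by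
    have h1 : ∑ j : J, b j * ⟪a j, u⟫ = 1 := by
      rw [← huu]
      nth_rw 2 [← hb]
      rw [sum_inner]
      simp [real_inner_smul_left]
    by_cases hi : i ∈ J
    · refine ⟨hi, ?_⟩
      rw [← h1, Finset.sum_eq_single ⟨i, hi⟩]
      · intro j _ hj
        rw [huj j j.2 (fun h => hj (Subtype.ext h)), mul_zero]
      · simp
    · rw [Finset.sum_eq_zero] at h1
      · simp at h1
      · intro j _
        rw [huj j j.2 (fun h => hi (h ▸ j.2)), mul_zero]
  have hsign : ∀ r : ℝ, ∃ σ : ℤˣ, σ • r = |r| := fun r => by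
    rcases le_total 0 r with h | h
    · exact ⟨1, by simp [abs_of_nonneg h]⟩
    · exact ⟨-1, by simp [abs_of_nonpos h, Units.smul_def]⟩
  choose σ hσ using hsign
  have hinv : ∀ (s : ℤˣ) (x y : E), ⟪s • x, y⟫ = s • ⟪x, y⟫ := fun s x y => by
    rcases Int.units_eq_one_or s with rfl | rfl <;> simp [Units.smul_def]
  -- On `J` the signs turn `t • u` into a combination of the new vectors with coefficients `|b j *
  -- t|`; off `J` they make the pairing with `u` nonpositive.
  let s : ι → ℤˣ := fun j => if h : j ∈ J then σ (b ⟨j, h⟩ * t) else -σ ⟪a j, u⟫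
  have hsJ : ∀ j : J, |b j * t| • (s j • a j) = (t * b j) • a j := fun j => by
    have hs : s j = σ (b j * t) := by simp [s]
    rw [hs]
    conv_lhs => rw [← hσ (b j * t)]
    rcases Int.units_eq_one_or (σ (b j * t)) with h | h <;> rw [h] <;>
      simp [Units.smul_def, mul_comm]
  have hsum : ∑ j : J, |b j * t| • (s j • a j) = t • u := by
    simp_rw [hsJ, ← hb, Finset.smul_sum, smul_smul]
  refine ⟨s, abs_le.2 ⟨?_, ?_⟩⟩
  · refine le_minMax fun x hx => ?_
    by_contra! hlt
    have h1 : ∑ j : J, |b j * t| * ⟪s j • a j, x⟫ = t * ⟪u, x⟫ := by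
      rw [← real_inner_smul_left, ← hsum, sum_inner]
      simp [real_inner_smul_left]
    -- Strictness comes from index `i`, whose coefficient is exactly one; the same coefficient makes
    -- the total weight at least one.
    have h2 : ∑ j : J, |b j * t| * ⟪s j • a j, x⟫ < ∑ j : J, |b j * t| * -|t| := by
      refine Finset.sum_lt_sum (fun j _ => mul_le_mul_of_nonneg_left (hlt j).le (abs_nonneg _))
        ⟨⟨i, hiJ⟩, Finset.mem_univ _, ?_⟩
      rw [hbt, abs_one, one_mul, one_mul]
      exact hlt i
    have h3 : 1 ≤ ∑ j : J, |b j * t| := by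
      have := Finset.single_le_sum (f := fun j : J => |b j * t|) (fun j _ => abs_nonneg _)
        (Finset.mem_univ ⟨i, hiJ⟩)
      simpa [hbt] using this
    have h4 : -|t| ≤ t * ⟪u, x⟫ := by
      refine neg_le_of_abs_le ?_
      rw [abs_mul]
      have := abs_real_inner_le_norm u x
      rw [hu, hx, one_mul] at this
      exact mul_le_of_le_one_right (abs_nonneg _) this
    rw [← Finset.sum_mul] at h2
    nlinarith [abs_nonneg t]
  · refine minMax_le hu fun j => ?_
    rw [hinv]
    by_cases hj : j ∈ J
    · by_cases hji : j = i
      · subst hji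
        have hs : s j = σ (b ⟨j, hj⟩ * t) := by simp [s, hj]
        have h1 := hσ 1
        rw [hs, hbt]
        rcases Int.units_eq_one_or (σ 1) with h | h
        · rw [h, one_smul]
          exact le_abs_self _
        · rw [h] at h1
          norm_num [Units.smul_def] at h1
      · rw [huj j hj hji, smul_zero]
        exact abs_nonneg t
    · have hs : s j = -σ ⟪a j, u⟫ := by simp [s, hj]
      have : s j • ⟪a j, u⟫ = -|⟪a j, u⟫| := by
        rw [hs, ← hσ, Units.smul_def, Units.smul_def, Units.val_neg, neg_smul]
      rw [this]
      exact (neg_nonpos.2 (abs_nonneg _)).trans (abs_nonneg t)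

end MinMax

/-- Since `arccos` is antitone, it exchanges the max-min of angles with the min-max of inner
products. -/
theorem cos_theta_eq_minMax {n m : ℕ} [NeZero n] [NeZero m] (A : Matrix (Fin n) (Fin m) ℝ)
    (hA : ∀ i, ‖rowVec A i‖ = 1) : Real.cos (theta A) = minMax (rowVec A) := by
  have : Nontrivial (EuclideanSpace ℝ (Fin m)) := by
    refine Module.nontrivial_of_finrank_pos (R := ℝ) ?_
    rw [finrank_euclideanSpace_fin]
    exact Nat.pos_of_ne_zero (NeZero.ne m)
  obtain ⟨x, hx, hax⟩ := exists_inner_le_minMax (rowVec A)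
  have hx0 : x ≠ 0 := by
    rintro rfl
    simp at hx
  have hle : ∀ y : EuclideanSpace ℝ (Fin m), y ≠ 0 →
      thetaAt A y ≤ Real.arccos (minMax (rowVec A)) := fun y hy => by
    have hyn : 0 < ‖y‖ := norm_pos_iff.2 hy
    obtain ⟨i, hi⟩ := exists_minMax_le_inner (rowVec A) (x := ‖y‖⁻¹ • y) (by
      rw [norm_smul, norm_inv, norm_norm, inv_mul_cancel₀ hyn.ne'])
    refine (ciInf_le (finite_range _).bddBelow i).trans ?_
    rw [InnerProductGeometry.angle, hA, one_mul]
    refine Real.arccos_le_arccos (hi.trans (le_of_eq ?_))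
    rw [inner_smul_right, inv_mul_eq_div]
  have htheta : theta A = Real.arccos (minMax (rowVec A)) := by
    have : Nonempty {x : EuclideanSpace ℝ (Fin m) // x ≠ 0} := ⟨⟨x, hx0⟩⟩
    refine le_antisymm (ciSup_le fun y => hle y.1 y.2) ?_
    refine le_trans ?_ (le_ciSup (f := fun y : {x : EuclideanSpace ℝ (Fin m) // x ≠ 0} =>
      thetaAt A y.1) ⟨_, by rintro _ ⟨y, rfl⟩; exact hle y.1 y.2⟩ ⟨x, hx0⟩)
    refine le_ciInf fun i => ?_
    rw [InnerProductGeometry.angle, hA, hx, one_mul, div_one]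
    exact Real.arccos_le_arccos (hax i)
  rw [htheta, Real.cos_arccos]
  · refine le_minMax fun y hy => ⟨0, neg_le_of_abs_le ?_⟩
    have := abs_real_inner_le_norm (rowVec A 0) y
    rwa [hA, hy, one_mul] at this
  · refine minMax_le hx fun i => ?_
    have := real_inner_le_norm (rowVec A i) x
    rwa [hA, hx, one_mul] at this

/-! ### The uniform measure on the sphere and its strips -/

section UniformSphere

/-- Surface measure is the dimension times the volume of the cone over `S`; the dimension cancels on
normalizing, which reduces strip estimates to volumes. -/
theorem uniformSphere_apply (m : ℕ) [NeZero m] {S : Set (EuclideanSpace ℝ (Fin m))}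
    (hS : MeasurableSet S) :
    uniformSphere m S = (volume (ball (0 : EuclideanSpace ℝ (Fin m)) 1))⁻¹ *
      volume {x : EuclideanSpace ℝ (Fin m) | (0 < ‖x‖ ∧ ‖x‖ < 1) ∧ ‖x‖⁻¹ • x ∈ S} := by
  have hset : Ioo (0 : ℝ) 1 • (Subtype.val '' (Subtype.val ⁻¹' S :
      Set (sphere (0 : EuclideanSpace ℝ (Fin m)) 1)))
      = {x | (0 < ‖x‖ ∧ ‖x‖ < 1) ∧ ‖x‖⁻¹ • x ∈ S} := by
    ext x
    rw [Set.mem_smul]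
    constructor
    · rintro ⟨r, ⟨hr0, hr1⟩, _, ⟨y, hy, rfl⟩, rfl⟩
      have hn : ‖r • (y : EuclideanSpace ℝ (Fin m))‖ = r := by
        rw [norm_smul, norm_eq_of_mem_sphere y, mul_one, Real.norm_of_nonneg hr0.le]
      refine ⟨by rw [hn]; exact ⟨hr0, hr1⟩, ?_⟩
      rw [hn, smul_smul, inv_mul_cancel₀ hr0.ne', one_smul]
      exact hy
    · rintro ⟨hx, hxS⟩
      refine ⟨‖x‖, hx, ‖x‖⁻¹ • x, ⟨⟨‖x‖⁻¹ • x, ?_⟩, hxS, rfl⟩, ?_⟩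
      · rw [mem_sphere_zero_iff_norm, norm_smul, norm_inv, norm_norm, inv_mul_cancel₀ hx.1.ne']
      · rw [smul_smul, mul_inv_cancel₀ hx.1.ne', one_smul]
  have hd : (Module.finrank ℝ (EuclideanSpace ℝ (Fin m)) : ℝ≥0∞) ≠ 0 := by
    simp [NeZero.ne m]
  rw [uniformSphere, Measure.map_apply measurable_subtype_coe hS, Measure.smul_apply, smul_eq_mul,
    Measure.toSphere_apply' _ (measurable_subtype_coe hS), Measure.toSphere_apply_univ, hset,
    ENNReal.mul_inv (Or.inl hd) (Or.inl (ENNReal.natCast_ne_top _)), mul_mul_mul_comm,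
    ENNReal.inv_mul_cancel hd (ENNReal.natCast_ne_top _), one_mul]

instance isProbabilityMeasure_uniformSphere (m : ℕ) [NeZero m] :
    IsProbabilityMeasure (uniformSphere m) := by
  refine ⟨?_⟩
  have h0 : (volume : Measure (EuclideanSpace ℝ (Fin m))).toSphere univ ≠ 0 := by
    rw [Measure.toSphere_apply_univ]
    simp [NeZero.ne m, (measure_ball_pos volume (0 : EuclideanSpace ℝ (Fin m)) one_pos).ne']
  rw [uniformSphere, Measure.map_apply measurable_subtype_coe .univ, preimage_univ,
    Measure.smul_apply, smul_eq_mul, ENNReal.inv_mul_cancel h0 (measure_ne_top _ _)]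

theorem ae_norm_eq_one_uniformSphere (m : ℕ) : ∀ᵐ x ∂uniformSphere m, ‖x‖ = 1 := by
  rw [uniformSphere, ae_map_iff measurable_subtype_coe.aemeasurable
    (measurableSet_eq_fun measurable_norm measurable_const)]
  exact .of_forall fun x => norm_eq_of_mem_sphere x

theorem measurePreserving_neg_uniformSphere (m : ℕ) [NeZero m] :
    MeasurePreserving (fun x => -x) (uniformSphere m) (uniformSphere m) := by
  refine ⟨measurable_neg, Measure.ext fun S hS => ?_⟩
  rw [Measure.map_apply measurable_neg hS, uniformSphere_apply m (measurable_neg hS),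
    uniformSphere_apply m hS]
  congr 1
  have := Measure.measure_preimage_neg (volume : Measure (EuclideanSpace ℝ (Fin m)))
    {x | (0 < ‖x‖ ∧ ‖x‖ < 1) ∧ ‖x‖⁻¹ • x ∈ S}
  rw [← this]
  congr 1
  ext x
  simp

theorem measurePreserving_units_smul_uniformSphere (m : ℕ) [NeZero m] (s : ℤˣ) :
    MeasurePreserving (fun x => s • x) (uniformSphere m) (uniformSphere m) := by
  rcases Int.units_eq_one_or s with rfl | rfl
  · simp_rw [one_smul]
    exact MeasurePreserving.id _
  · simpa [Units.smul_def] using measurePreserving_neg_uniformSphere m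

/-- Orthogonal coordinates whose first axis is a given unit vector. -/
theorem exists_measurePreserving_prod {k : ℕ} {u : EuclideanSpace ℝ (Fin (k + 1))} (hu : ‖u‖ = 1) :
    ∃ φ : EuclideanSpace ℝ (Fin (k + 1)) → ℝ × EuclideanSpace ℝ (Fin k),
      MeasurePreserving φ ∧ (∀ x, (φ x).1 = ⟪x, u⟫) ∧
      ∀ x, ‖x‖ ^ 2 = (φ x).1 ^ 2 + ‖(φ x).2‖ ^ 2 := by
  obtain ⟨b, hb⟩ := Orthonormal.exists_orthonormalBasis_extension_of_card_eq (𝕜 := ℝ)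
    (E := EuclideanSpace ℝ (Fin (k + 1))) (ι := Fin (k + 1)) (by simp)
    (v := fun _ => u) (s := {0}) (by
      refine ⟨fun _ => hu, fun i j hij => absurd (Subsingleton.elim i j) hij⟩)
  have hb0 : b 0 = u := hb 0 rfl
  refine ⟨fun x => (b.repr x 0, WithLp.toLp 2 fun j => b.repr x j.succ), ?_, fun x => ?_,
    fun x => ?_⟩
  · have h1 := (PiLp.volume_preserving_ofLp (Fin (k + 1))).comp b.measurePreserving_repr
    have h2 := (volume_preserving_piFinSuccAbove (fun _ : Fin (k + 1) => ℝ) 0).comp h1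
    exact ((MeasurePreserving.id volume).prod (PiLp.volume_preserving_toLp (Fin k))).comp h2
  · beta_reduce
    rw [b.repr_apply_apply, hb0, real_inner_comm]
  · rw [← b.repr.norm_map x, EuclideanSpace.norm_sq_eq, EuclideanSpace.norm_sq_eq,
      Fin.sum_univ_succ]
    simp

/-- Log-convexity of `Γ` at the midpoint of `s` and `s + 1`. -/
theorem Gamma_add_half_le {s : ℝ} (hs : 0 < s) :
    Real.Gamma (s + 1 / 2) ≤ Real.Gamma s * √s := by
  have h := Real.Gamma_mul_add_mul_le_rpow_Gamma_mul_rpow_Gamma hs (add_pos hs one_pos)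
    one_half_pos one_half_pos (by norm_num)
  have hG := Real.Gamma_pos_of_pos hs
  rw [Real.Gamma_add_one hs.ne', Real.mul_rpow hs.le hG.le, mul_left_comm,
    ← Real.rpow_add hG, ← Real.sqrt_eq_rpow] at h
  calc Real.Gamma (s + 1 / 2) = Real.Gamma (1 / 2 * s + 1 / 2 * (s + 1)) := by
        congr 1; ring
    _ ≤ _ := h
    _ = Real.Gamma s * √s := by norm_num [mul_comm]

theorem volume_ball_le_sqrt_mul_volume_ball_succ (k : ℕ) [NeZero k] :
    volume (ball (0 : EuclideanSpace ℝ (Fin k)) 1) ≤ ENNReal.ofReal √((k + 1 : ℕ) : ℝ) *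
      volume (ball (0 : EuclideanSpace ℝ (Fin (k + 1))) 1) := by
  rw [EuclideanSpace.volume_ball, EuclideanSpace.volume_ball]
  simp only [ENNReal.ofReal_one, one_pow, one_mul, Fintype.card_fin]
  rw [← ENNReal.ofReal_mul (Real.sqrt_nonneg _)]
  refine ENNReal.ofReal_le_ofReal ?_
  have hs : (0 : ℝ) < k / 2 + 1 := by positivity
  have hG := Real.Gamma_pos_of_pos hs
  have h1 := Gamma_add_half_le hs
  have e : ((k + 1 : ℕ) : ℝ) / 2 + 1 = k / 2 + 1 + 1 / 2 := by push_cast; ring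
  have hG' : 0 < Real.Gamma ((k : ℝ) / 2 + 1 + 1 / 2) := Real.Gamma_pos_of_pos (by positivity)
  have h2 : √((k : ℝ) / 2 + 1) ≤ √((k + 1 : ℕ) : ℝ) * √Real.pi := by
    rw [← Real.sqrt_mul (Nat.cast_nonneg _)]
    refine Real.sqrt_le_sqrt ?_
    push_cast
    nlinarith [Real.pi_gt_three, (Nat.cast_nonneg k : (0 : ℝ) ≤ k)]
  rw [e, ← mul_div_assoc, div_le_div_iff₀ hG hG', pow_succ]
  have hp : 0 ≤ √Real.pi ^ k := by positivity
  calc √Real.pi ^ k * Real.Gamma (k / 2 + 1 + 1 / 2)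
      ≤ √Real.pi ^ k * (Real.Gamma (k / 2 + 1) * (√((k + 1 : ℕ) : ℝ) * √Real.pi)) :=
        mul_le_mul_of_nonneg_left (h1.trans (mul_le_mul_of_nonneg_left h2 hG.le)) hp
    _ = _ := by ring

theorem measurableSet_abs_inner_lt {m : ℕ} (u : EuclideanSpace ℝ (Fin m)) (δ : ℝ) :
    MeasurableSet {x : EuclideanSpace ℝ (Fin m) | |⟪x, u⟫| < δ} :=
  measurableSet_lt (by fun_prop) measurable_const

/-- A spherical strip of half-width `δ` has probability at most `2 √m δ`. -/
theorem uniformSphere_strip_le {m : ℕ} (hm : 2 ≤ m) {u : EuclideanSpace ℝ (Fin m)} (hu : ‖u‖ = 1)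
    (δ : ℝ) :
    uniformSphere m {x | |⟪x, u⟫| < δ} ≤ ENNReal.ofReal (2 * √(m : ℝ) * δ) := by
  obtain ⟨k, rfl⟩ : ∃ k, m = k + 1 := ⟨m - 1, by omega⟩
  have : NeZero k := ⟨by omega⟩
  rw [uniformSphere_apply _ (measurableSet_abs_inner_lt u δ)]
  obtain ⟨φ, hφ, hφ1, hφ2⟩ := exists_measurePreserving_prod hu
  -- The cone over the strip lies in a cylinder of height `2 δ` over the unit ball one dimension
  -- lower.
  have hsub : {x : EuclideanSpace ℝ (Fin (k + 1)) | (0 < ‖x‖ ∧ ‖x‖ < 1) ∧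
      ‖x‖⁻¹ • x ∈ {x | |⟪x, u⟫| < δ}} ⊆ φ ⁻¹' (Ioo (-δ) δ ×ˢ ball 0 1) := by
    rintro x ⟨⟨hx0, hx1⟩, hxS⟩
    rw [mem_ofPred_eq, real_inner_smul_left, abs_mul, abs_inv, abs_norm, inv_mul_eq_div,
      div_lt_iff₀ hx0] at hxS
    have hδ : 0 < δ := by
      by_contra! h
      nlinarith [abs_nonneg ⟪x, u⟫]
    refine ⟨abs_lt.1 ?_, ?_⟩
    · rw [hφ1]
      nlinarith
    · rw [mem_ball_zero_iff, ← sq_lt_one_iff₀ (norm_nonneg _)]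
      nlinarith [hφ2 x, sq_nonneg (φ x).1]
  have hV0 := (measure_ball_pos volume (0 : EuclideanSpace ℝ (Fin (k + 1))) one_pos).ne'
  have hVt := (measure_ball_lt_top (μ := volume) (x := (0 : EuclideanSpace ℝ (Fin (k + 1))))
    (r := 1)).ne
  calc _ ≤ (volume (ball (0 : EuclideanSpace ℝ (Fin (k + 1))) 1))⁻¹ *
        volume (φ ⁻¹' (Ioo (-δ) δ ×ˢ ball 0 1)) := by gcongr
    _ = (volume (ball (0 : EuclideanSpace ℝ (Fin (k + 1))) 1))⁻¹ * (ENNReal.ofReal (2 * δ) *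
        volume (ball (0 : EuclideanSpace ℝ (Fin k)) 1)) := by
      rw [hφ.measure_preimage (measurableSet_Ioo.prod measurableSet_ball).nullMeasurableSet,
        Measure.volume_eq_prod, Measure.prod_prod, Real.volume_Ioo, sub_neg_eq_add, two_mul]
    _ ≤ (volume (ball (0 : EuclideanSpace ℝ (Fin (k + 1))) 1))⁻¹ * (ENNReal.ofReal (2 * δ) *
        (ENNReal.ofReal √((k + 1 : ℕ) : ℝ) *
          volume (ball (0 : EuclideanSpace ℝ (Fin (k + 1))) 1))) := by
      gcongr
      exact volume_ball_le_sqrt_mul_volume_ball_succ k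
    _ = ENNReal.ofReal √((k + 1 : ℕ) : ℝ) * ENNReal.ofReal (2 * δ) *
        ((volume (ball (0 : EuclideanSpace ℝ (Fin (k + 1))) 1))⁻¹ *
          volume (ball (0 : EuclideanSpace ℝ (Fin (k + 1))) 1)) := by ring
    _ = ENNReal.ofReal (2 * √((k + 1 : ℕ) : ℝ) * δ) := by
      rw [ENNReal.inv_mul_cancel hV0 hVt, mul_one, ← ENNReal.ofReal_mul (Real.sqrt_nonneg _)]
      congr 1
      ring

/-- Linear lower bound behind the divergence. The equator is removed because the real inverse of
zero is zero, so it would not count as a large value. -/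
theorem exists_le_uniformSphere_strip {m : ℕ} (hm : 2 ≤ m) {u : EuclideanSpace ℝ (Fin m)}
    (hu : ‖u‖ = 1) : ∃ c : ℝ≥0∞, c ≠ 0 ∧ ∀ δ : ℝ, 0 < δ → δ ≤ 1 →
      c * ENNReal.ofReal δ ≤ uniformSphere m {x | 0 < |⟪x, u⟫| ∧ |⟪x, u⟫| < δ} := by
  obtain ⟨k, rfl⟩ : ∃ k, m = k + 1 := ⟨m - 1, by omega⟩
  have : NeZero k := ⟨by omega⟩
  obtain ⟨φ, hφ, hφ1, hφ2⟩ := exists_measurePreserving_prod hu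
  -- On this shell `‖x‖ > 1/4`, so height below `δ / 4` normalizes to height below `δ`; the outer
  -- radius keeps `x` in the unit ball.
  set Y : Set (EuclideanSpace ℝ (Fin k)) := ball 0 (1 / 2) \ closedBall 0 (1 / 4) with hY
  have hYo : IsOpen Y := isOpen_ball.sdiff isClosed_closedBall
  have hYn : Y.Nonempty := by
    obtain ⟨y, hy⟩ := (NormedSpace.sphere_nonempty (x := (0 : EuclideanSpace ℝ (Fin k)))
      (r := 1 / 3)).2 (by norm_num)
    rw [mem_sphere_zero_iff_norm] at hy
    exact ⟨y, by rw [mem_ball_zero_iff, hy]; norm_num,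
      by rw [mem_closedBall_zero_iff, hy]; norm_num⟩
  have hVt := (measure_ball_lt_top (μ := volume) (x := (0 : EuclideanSpace ℝ (Fin (k + 1))))
    (r := 1)).ne
  refine ⟨(volume (ball (0 : EuclideanSpace ℝ (Fin (k + 1))) 1))⁻¹ *
    (ENNReal.ofReal (1 / 4) * volume Y), ?_, fun δ hδ0 hδ1 => ?_⟩
  · refine mul_ne_zero (ENNReal.inv_ne_zero.2 hVt) (mul_ne_zero ?_ (hYo.measure_pos _ hYn).ne')
    norm_num
  · have hS : MeasurableSet {x : EuclideanSpace ℝ (Fin (k + 1)) |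
        0 < |⟪x, u⟫| ∧ |⟪x, u⟫| < δ} :=
      MeasurableSet.inter (s₁ := {x | 0 < |⟪x, u⟫|})
        (measurableSet_lt measurable_const (by fun_prop)) (measurableSet_abs_inner_lt u δ)
    rw [uniformSphere_apply _ hS]
    have hsub : φ ⁻¹' (Ioo 0 (1 / 4 * δ) ×ˢ Y) ⊆ {x : EuclideanSpace ℝ (Fin (k + 1)) |
        (0 < ‖x‖ ∧ ‖x‖ < 1) ∧ ‖x‖⁻¹ • x ∈ {x | 0 < |⟪x, u⟫| ∧ |⟪x, u⟫| < δ}} := by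
      rintro x ⟨⟨h0, h1⟩, h2, h3⟩
      rw [mem_ball_zero_iff] at h2
      rw [mem_closedBall_zero_iff, not_le] at h3
      have hx := hφ2 x
      have hxl : 1 / 4 < ‖x‖ := by
        refine lt_of_pow_lt_pow_left₀ 2 (norm_nonneg _) ?_
        nlinarith
      have hxu : ‖x‖ < 1 := by
        refine lt_of_pow_lt_pow_left₀ 2 zero_le_one ?_
        nlinarith
      have hx0 : 0 < ‖x‖ := by linarith
      refine ⟨⟨hx0, hxu⟩, ?_⟩
      rw [mem_ofPred_eq, real_inner_smul_left, ← hφ1, abs_mul, abs_inv, abs_norm, inv_mul_eq_div,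
        abs_of_pos h0, div_lt_iff₀ hx0]
      refine ⟨by positivity, ?_⟩
      nlinarith
    calc _ = (volume (ball (0 : EuclideanSpace ℝ (Fin (k + 1))) 1))⁻¹ *
          volume (φ ⁻¹' (Ioo 0 (1 / 4 * δ) ×ˢ Y)) := by
          rw [hφ.measure_preimage (measurableSet_Ioo.prod hYo.measurableSet).nullMeasurableSet,
            Measure.volume_eq_prod, Measure.prod_prod, Real.volume_Ioo, sub_zero,
            ENNReal.ofReal_mul (by norm_num)]
          ring
      _ ≤ _ := by gcongr

/-- By layer cake: the inverse exceeds `t` with probability at least `c / t`, which is not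
integrable at infinity. -/
theorem lintegral_inv_abs_inner_uniformSphere {m : ℕ} (hm : 2 ≤ m)
    {u : EuclideanSpace ℝ (Fin m)} (hu : ‖u‖ = 1) :
    ∫⁻ x, (ENNReal.ofReal |⟪x, u⟫|)⁻¹ ∂uniformSphere m = ⊤ := by
  obtain ⟨c, hc, hcδ⟩ := exists_le_uniformSphere_strip hm hu
  rw [eq_top_iff]
  have hmeas : AEMeasurable (fun x : EuclideanSpace ℝ (Fin m) => |⟪x, u⟫|⁻¹) (uniformSphere m) := by
    fun_prop
  have hinv : ∫⁻ t in Ioi (1 : ℝ), ENNReal.ofReal t⁻¹ = ⊤ := by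
    by_contra h
    refine not_integrableOn_Ioi_inv (a := 1) ⟨by fun_prop, ?_⟩
    rw [hasFiniteIntegral_iff_ofReal]
    · exact lt_top_iff_ne_top.2 h
    · filter_upwards [ae_restrict_mem measurableSet_Ioi] with t ht
      exact inv_nonneg.2 (zero_le_one.trans (le_of_lt ht))
  calc (⊤ : ℝ≥0∞) = ∫⁻ t in Ioi (1 : ℝ), c * ENNReal.ofReal t⁻¹ := by
        rw [lintegral_const_mul _ (by fun_prop), hinv, ENNReal.mul_top hc]
    _ ≤ ∫⁻ t in Ioi (1 : ℝ), uniformSphere m {x | t < |⟪x, u⟫|⁻¹} := by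
        refine setLIntegral_mono' measurableSet_Ioi fun t ht => ?_
        have ht0 : 0 < t := zero_lt_one.trans ht
        refine (hcδ t⁻¹ (inv_pos.2 ht0) (inv_le_one_of_one_le₀ (le_of_lt ht))).trans
          (measure_mono fun x hx => ?_)
        exact (lt_inv_comm₀ hx.1 ht0).1 hx.2
    _ ≤ ∫⁻ t in Ioi (0 : ℝ), uniformSphere m {x | t < |⟪x, u⟫|⁻¹} :=
        lintegral_mono_set (Ioi_subset_Ioi zero_le_one)
    _ = ∫⁻ x, ENNReal.ofReal |⟪x, u⟫|⁻¹ ∂uniformSphere m :=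
        (lintegral_eq_lintegral_meas_lt _ (.of_forall fun x => inv_nonneg.2 (abs_nonneg _))
          hmeas).symm
    _ ≤ _ := by
        refine lintegral_mono fun x => ?_
        rcases (abs_nonneg ⟪x, u⟫).eq_or_lt with h | h
        · simp [← h]
        · exact (ENNReal.ofReal_inv_of_pos h).le

end UniformSphere

/-! ### Conditioning on all coordinates but one -/

section ProductMeasure

variable {α : Type*} [MeasurableSpace α]

theorem measurePreserving_insertNth {k : ℕ} (μ : Measure α) [SigmaFinite μ] (i : Fin (k + 1)) :
    MeasurePreserving (fun p : (Fin k → α) × α => (i.insertNth p.2 p.1 : Fin (k + 1) → α))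
      ((Measure.pi fun _ : Fin k => μ).prod μ) (Measure.pi fun _ : Fin (k + 1) => μ) :=
  ((measurePreserving_piFinSuccAbove (fun _ : Fin (k + 1) => μ) i).symm _).comp
    Measure.measurePreserving_swap

theorem pi_le_of_forall_insertNth_le {k : ℕ} (μ : Measure α) [IsProbabilityMeasure μ]
    (i : Fin (k + 1)) {B : Set (Fin (k + 1) → α)} (hB : MeasurableSet B) {C : ℝ≥0∞}
    (h : ∀ r : Fin k → α, μ {x | (i.insertNth x r : Fin (k + 1) → α) ∈ B} ≤ C) :
    Measure.pi (fun _ => μ) B ≤ C := by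
  have hψ := measurePreserving_insertNth μ i
  rw [← hψ.measure_preimage hB.nullMeasurableSet, Measure.prod_apply (hψ.measurable hB)]
  refine (lintegral_mono fun r => h r).trans ?_
  simp

end ProductMeasure

/-! ### Vectors near the hyperplane spanned by others -/

section NearHyperplane

variable {ι E : Type*} [NormedAddCommGroup E] [InnerProductSpace ℝ E]

/-- The families `a` such that `a i` is at distance less than `δ` from every hyperplane through the
origin that contains the vectors `a j`, `j ∈ J \ {i}`. -/
def nearHyperplane (E : Type*) [NormedAddCommGroup E] [InnerProductSpace ℝ E]
    (J : Finset ι) (i : ι) (δ : ℝ) : Set (ι → E) :=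
  {a | ∀ u : E, ‖u‖ = 1 → (∀ j ∈ J, j ≠ i → ⟪a j, u⟫ = 0) → |⟪a i, u⟫| < δ}

/-- The complement is the projection of a closed set along the compact sphere. Openness supplies
measurability despite the uncountable quantifier over `u`. -/
theorem isOpen_nearHyperplane [FiniteDimensional ℝ E] (J : Finset ι) (i : ι) (δ : ℝ) :
    IsOpen (nearHyperplane E J i δ) := by
  have : CompactSpace (sphere (0 : E) 1) := isCompact_iff_compactSpace.1 (isCompact_sphere _ _)
  have hcl : IsClosed {p : sphere (0 : E) 1 × (ι → E) |
      (∀ j ∈ J, j ≠ i → ⟪p.2 j, (p.1 : E)⟫ = 0) ∧ δ ≤ |⟪p.2 i, (p.1 : E)⟫|} := by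
    refine IsClosed.and ?_ ?_
    · simp only [ofPred_forall]
      refine isClosed_biInter fun j _ => isClosed_iInter fun _ => ?_
      exact isClosed_eq (by fun_prop) continuous_const
    · exact isClosed_le continuous_const (by fun_prop)
  have himg : nearHyperplane E J i δ = (Prod.snd '' {p : sphere (0 : E) 1 × (ι → E) |
      (∀ j ∈ J, j ≠ i → ⟪p.2 j, (p.1 : E)⟫ = 0) ∧ δ ≤ |⟪p.2 i, (p.1 : E)⟫|})ᶜ := by
    ext a
    constructor
    · rintro ha ⟨⟨u, b⟩, ⟨h1, h2⟩, rfl⟩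
      exact absurd (ha u (norm_eq_of_mem_sphere u) h1) (not_lt.2 h2)
    · intro ha u hu huj
      by_contra! hδ
      exact ha ⟨(⟨u, by simpa using hu⟩, a), ⟨huj, hδ⟩, rfl⟩
  rw [himg]
  exact (isClosedMap_snd_of_compactSpace _ hcl).isOpen_compl

theorem exists_unit_forall_inner_eq_zero [FiniteDimensional ℝ E] (a : ι → E) {J : Finset ι}
    (hJ : J.card < Module.finrank ℝ E) : ∃ u : E, ‖u‖ = 1 ∧ ∀ j ∈ J, ⟪a j, u⟫ = 0 := by
  classical
  have hlt : Submodule.span ℝ (J.image a : Set E) ≠ ⊤ := by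
    intro h
    have h1 := finrank_span_finset_le_card (R := ℝ) (J.image a)
    rw [Set.finrank, h, finrank_top] at h1
    exact absurd (h1.trans Finset.card_image_le) (not_le.2 hJ)
  obtain ⟨v, hv, hv0⟩ := Submodule.exists_mem_ne_zero_of_ne_bot
    (fun h => hlt (Submodule.orthogonal_eq_bot_iff.1 h))
  refine ⟨‖v‖⁻¹ • v, ?_, fun j hj => ?_⟩
  · rw [norm_smul, norm_inv, norm_norm, inv_mul_cancel₀ (norm_ne_zero_iff.2 hv0)]
  · rw [inner_smul_right, (Submodule.mem_orthogonal _ _).1 hv, mul_zero]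
    exact Submodule.subset_span (by simpa using ⟨j, hj, rfl⟩)

end NearHyperplane

theorem measurable_inv_abs_minMax {ι E : Type*} [Fintype ι] [Nonempty ι] [NormedAddCommGroup E]
    [InnerProductSpace ℝ E] [FiniteDimensional ℝ E] [MeasurableSpace E] [BorelSpace E] :
    Measurable fun a : ι → E => (ENNReal.ofReal |minMax a|)⁻¹ :=
  measurable_minMax.abs.ennreal_ofReal.inv

/-! ### Tail bound and divergence for random vectors -/

section RandomVectors

variable {m k : ℕ}

/-- The normal `u` depends only on the frozen vectors `r`, so it stays fixed while `x` is
integrated. -/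
theorem exists_unit_forall_insertNth (hm : 1 ≤ m) {J : Finset (Fin (k + 1))} (hJ : J.card = m)
    {i : Fin (k + 1)} (hi : i ∈ J) (r : Fin k → EuclideanSpace ℝ (Fin m)) :
    ∃ u : EuclideanSpace ℝ (Fin m), ‖u‖ = 1 ∧ ∀ x, ∀ j ∈ J, j ≠ i →
      ⟪(i.insertNth x r : Fin (k + 1) → EuclideanSpace ℝ (Fin m)) j, u⟫ = 0 := by
  obtain ⟨u, hu, huj⟩ := exists_unit_forall_inner_eq_zero
    (i.insertNth 0 r : Fin (k + 1) → EuclideanSpace ℝ (Fin m)) (J := J.erase i) (by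
      rw [Finset.card_erase_of_mem hi, finrank_euclideanSpace_fin]
      omega)
  refine ⟨u, hu, fun x j hj hji => ?_⟩
  have := huj j (Finset.mem_erase.2 ⟨hji, hj⟩)
  obtain ⟨l, rfl⟩ := Fin.exists_succAbove_eq hji
  rwa [Fin.insertNth_apply_succAbove] at this ⊢

theorem pi_nearHyperplane_le (hm : 2 ≤ m) {J : Finset (Fin (k + 1))} (hJ : J.card = m)
    {i : Fin (k + 1)} (hi : i ∈ J) (δ : ℝ) :
    Measure.pi (fun _ => uniformSphere m) (nearHyperplane (EuclideanSpace ℝ (Fin m)) J i δ) ≤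
      ENNReal.ofReal (2 * √(m : ℝ) * δ) := by
  have : NeZero m := ⟨by omega⟩
  refine pi_le_of_forall_insertNth_le _ i (isOpen_nearHyperplane J i δ).measurableSet fun r => ?_
  obtain ⟨u, hu, huj⟩ := exists_unit_forall_insertNth (by omega) hJ hi r
  refine (measure_mono fun x hx => ?_).trans (uniformSphere_strip_le hm hu δ)
  have h := hx u hu (huj x)
  rwa [Fin.insertNth_apply_same] at h

/-- Without a vector `u` detecting `a i` alone, the sample lies in the near-hyperplane event for
every `δ > 0`, so letting `δ → 0` gives probability zero. Such a `u` for each `i` forces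
independence. -/
theorem ae_linearIndependent_pi_uniformSphere (hm : 2 ≤ m) {J : Finset (Fin (k + 1))}
    (hJ : J.card = m) :
    ∀ᵐ a ∂Measure.pi fun _ : Fin (k + 1) => uniformSphere m,
      LinearIndependent ℝ fun j : J => a j := by
  have h1 : ∀ i : J, ∀ᵐ a ∂Measure.pi fun _ : Fin (k + 1) => uniformSphere m,
      ∃ u : EuclideanSpace ℝ (Fin m), (∀ j ∈ J, j ≠ i → ⟪a j, u⟫ = 0) ∧ ⟪a i, u⟫ ≠ 0 := by
    intro i
    rw [ae_iff, ← nonpos_iff_eq_zero]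
    have hle : ∀ δ : ℝ, 0 < δ → (Measure.pi fun _ : Fin (k + 1) => uniformSphere m)
        {a | ¬∃ u : EuclideanSpace ℝ (Fin m), (∀ j ∈ J, j ≠ i → ⟪a j, u⟫ = 0) ∧ ⟪a i, u⟫ ≠ 0} ≤
          ENNReal.ofReal (2 * √(m : ℝ) * δ) := fun δ hδ => by
      refine (measure_mono fun a ha u _ huj => ?_).trans (pi_nearHyperplane_le hm hJ i.2 δ)
      have h0 : ⟪a i, u⟫ = 0 := by
        by_contra h0
        exact ha ⟨u, huj, h0⟩
      rwa [h0, abs_zero]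
    have hlim : Filter.Tendsto (fun δ : ℝ => ENNReal.ofReal (2 * √(m : ℝ) * δ))
        (nhdsWithin 0 (Ioi 0)) (nhds 0) := by
      have hc : Continuous fun δ : ℝ => ENNReal.ofReal (2 * √(m : ℝ) * δ) :=
        ENNReal.continuous_ofReal.comp (continuous_const.mul continuous_id)
      simpa using (hc.tendsto 0).mono_left nhdsWithin_le_nhds
    exact ge_of_tendsto hlim (by
      filter_upwards [self_mem_nhdsWithin] with δ hδ using hle δ hδ)
  filter_upwards [ae_all_iff.2 h1] with a ha
  rw [Fintype.linearIndependent_iff]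
  intro g hg i
  obtain ⟨u, huj, hui⟩ := ha i
  have h2 : ∑ j, g j * ⟪a j, u⟫ = 0 := by
    have := congrArg (fun v => ⟪v, u⟫) hg
    simpa [sum_inner, real_inner_smul_left] using this
  rw [Finset.sum_eq_single i] at h2
  · exact (mul_eq_zero.1 h2).resolve_right hui
  · intro j _ hji
    rw [huj j j.2 (fun h => hji (Subtype.ext h)), mul_zero]
  · simp

theorem pi_abs_minMax_lt_le (hm : 2 ≤ m) (hmk : m ≤ k + 1) (ε : ℝ) :
    Measure.pi (fun _ : Fin (k + 1) => uniformSphere m) {a | |minMax a| < ε} ≤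
      ENNReal.ofReal (((k + 1).choose m : ℝ) * (2 * (m : ℝ) ^ (5 / 2 : ℝ)) * ε) := by
  have hm0 : (0 : ℝ) ≤ m := Nat.cast_nonneg m
  -- One factor `m` counts the choices of `i`, one is the loss in `m * ε`, and `√m` is from the
  -- strip bound.
  have hmpow : (m : ℝ) ^ (5 / 2 : ℝ) = m * m * √(m : ℝ) := by
    rw [show (5 / 2 : ℝ) = 1 + 1 + 1 / 2 by norm_num, Real.rpow_add_of_nonneg hm0 (by norm_num)
      (by norm_num), Real.rpow_add_of_nonneg hm0 (by norm_num) (by norm_num), Real.rpow_one,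
      Real.sqrt_eq_rpow]
  have : Nontrivial (EuclideanSpace ℝ (Fin m)) := by
    refine Module.nontrivial_of_finrank_pos (R := ℝ) ?_
    rw [finrank_euclideanSpace_fin]
    omega
  have hsub : {a : Fin (k + 1) → EuclideanSpace ℝ (Fin m) | |minMax a| < ε} ⊆
      ⋃ J ∈ Finset.powersetCard m (Finset.univ : Finset (Fin (k + 1))), ⋃ i ∈ J,
        nearHyperplane (EuclideanSpace ℝ (Fin m)) J i (m * ε) := by
    intro a ha
    obtain ⟨J, hJ, i, hi, h⟩ := exists_abs_inner_lt_of_abs_minMax_lt (by simpa using hmk) a ha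
    rw [finrank_euclideanSpace_fin] at hJ h
    exact mem_biUnion hJ (mem_biUnion hi h)
  calc _ ≤ ∑ J ∈ Finset.powersetCard m (Finset.univ : Finset (Fin (k + 1))), ∑ i ∈ J,
        Measure.pi (fun _ => uniformSphere m)
          (nearHyperplane (EuclideanSpace ℝ (Fin m)) J i (m * ε)) :=
        (measure_mono hsub).trans ((measure_biUnion_finset_le _ _).trans
          (Finset.sum_le_sum fun J _ => measure_biUnion_finset_le _ _))
    _ ≤ ∑ J ∈ Finset.powersetCard m (Finset.univ : Finset (Fin (k + 1))), ∑ i ∈ J,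
        ENNReal.ofReal (2 * √(m : ℝ) * (m * ε)) :=
        Finset.sum_le_sum fun J hJ => Finset.sum_le_sum fun i hi =>
          pi_nearHyperplane_le hm (Finset.mem_powersetCard.1 hJ).2 hi _
    _ = ∑ J ∈ Finset.powersetCard m (Finset.univ : Finset (Fin (k + 1))),
        m * ENNReal.ofReal (2 * √(m : ℝ) * (m * ε)) :=
        Finset.sum_congr rfl fun J hJ => by
          rw [Finset.sum_const, (Finset.mem_powersetCard.1 hJ).2, nsmul_eq_mul]
    _ = ENNReal.ofReal (((k + 1).choose m : ℝ) * (2 * (m : ℝ) ^ (5 / 2 : ℝ)) * ε) := by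
        rw [Finset.sum_const, Finset.card_powersetCard, Finset.card_univ, Fintype.card_fin,
          nsmul_eq_mul, ← ENNReal.ofReal_natCast m, ← ENNReal.ofReal_natCast,
          ← ENNReal.ofReal_mul hm0, ← ENNReal.ofReal_mul (Nat.cast_nonneg _), hmpow]
        congr 1
        ring

theorem lintegral_inv_abs_minMax (hm : 2 ≤ m) (hmk : m ≤ k + 1) :
    ∫⁻ a, (ENNReal.ofReal |minMax a|)⁻¹ ∂Measure.pi (fun _ : Fin (k + 1) => uniformSphere m)
      = ⊤ := by
  have : NeZero m := ⟨by omega⟩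
  have : Nontrivial (EuclideanSpace ℝ (Fin m)) := by
    refine Module.nontrivial_of_finrank_pos (R := ℝ) ?_
    rw [finrank_euclideanSpace_fin]
    omega
  set F : (Fin (k + 1) → EuclideanSpace ℝ (Fin m)) → ℝ≥0∞ := fun a =>
    (ENNReal.ofReal |minMax a|)⁻¹ with hF
  have hFm : Measurable F := measurable_inv_abs_minMax
  have hs : ∀ s : Fin (k + 1) → ℤˣ, MeasurePreserving
      (fun (a : Fin (k + 1) → EuclideanSpace ℝ (Fin m)) j => s j • a j)
      (Measure.pi fun _ => uniformSphere m) (Measure.pi fun _ => uniformSphere m) := fun s =>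
    measurePreserving_pi _ _ fun j => measurePreserving_units_smul_uniformSphere m (s j)
  -- The good sign pattern depends on the sample; summing over all patterns avoids selecting it
  -- measurably.
  set G : (Fin (k + 1) → EuclideanSpace ℝ (Fin m)) → ℝ≥0∞ := fun a =>
    ∑ s : Fin (k + 1) → ℤˣ, F fun j => s j • a j with hG
  have hFs : ∀ s : Fin (k + 1) → ℤˣ, Measurable
      fun a : Fin (k + 1) → EuclideanSpace ℝ (Fin m) => F fun j => s j • a j := fun s =>
    hFm.comp (hs s).measurable
  have hGm : Measurable G := Finset.measurable_fun_sum _ fun s _ => hFs s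
  have hGF : ∫⁻ a, G a ∂Measure.pi (fun _ : Fin (k + 1) => uniformSphere m) =
      Fintype.card (Fin (k + 1) → ℤˣ) *
        ∫⁻ a, F a ∂Measure.pi (fun _ : Fin (k + 1) => uniformSphere m) := by
    rw [lintegral_finsetSum _ fun s _ => hFs s,
      Finset.sum_congr rfl fun s _ => (hs s).lintegral_comp hFm, Finset.sum_const,
      Finset.card_univ, nsmul_eq_mul]
  obtain ⟨J, h0J, hJ⟩ := Finset.exists_superset_card_eq (s := {(0 : Fin (k + 1))}) (n := m)
    (by simp; omega) (by simpa using hmk)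
  have h0 : (0 : Fin (k + 1)) ∈ J := h0J (Finset.mem_singleton_self _)
  have hψ := measurePreserving_insertNth (uniformSphere m) (0 : Fin (k + 1))
  have hGtop : ∫⁻ a, G a ∂Measure.pi (fun _ : Fin (k + 1) => uniformSphere m) = ⊤ := by
    have hGψ : Measurable fun p : (Fin k → EuclideanSpace ℝ (Fin m)) × EuclideanSpace ℝ (Fin m) =>
        G (Fin.insertNth 0 p.2 p.1) := hGm.comp hψ.measurable
    rw [← hψ.lintegral_comp hGm, lintegral_prod _ hGψ.aemeasurable]
    have hae := Measure.ae_ae_of_ae_prod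
      (hψ.quasiMeasurePreserving.ae (ae_linearIndependent_pi_uniformSphere hm hJ))
    rw [lintegral_congr_ae (g := fun _ => ⊤), lintegral_const, measure_univ, mul_one]
    filter_upwards [hae] with r hr
    obtain ⟨u, hu, huj⟩ := exists_unit_forall_insertNth (by omega) hJ h0 r
    rw [eq_top_iff, ← lintegral_inv_abs_inner_uniformSphere hm hu]
    refine lintegral_mono_ae ?_
    filter_upwards [hr] with x hx
    obtain ⟨s, hsle⟩ := exists_signs_abs_minMax_le _ (by simpa using hJ) hx hu (huj x)
    rw [Fin.insertNth_apply_same] at hsle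
    calc (ENNReal.ofReal |⟪x, u⟫|)⁻¹
        ≤ F fun j => s j • (Fin.insertNth 0 x r : Fin (k + 1) → EuclideanSpace ℝ (Fin m)) j :=
          ENNReal.inv_le_inv.2 (ENNReal.ofReal_le_ofReal hsle)
      _ ≤ _ := Finset.single_le_sum (f := fun s : Fin (k + 1) → ℤˣ => F fun j =>
          s j • (Fin.insertNth 0 x r : Fin (k + 1) → EuclideanSpace ℝ (Fin m)) j)
          (fun _ _ => zero_le) (Finset.mem_univ s)
  rw [hGF] at hGtop
  by_contra hne
  exact ENNReal.mul_ne_top (ENNReal.natCast_ne_top _) hne hGtop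

end RandomVectors

/-! ### From the tail to moments, and transfer to the random matrix -/

/-- If `P (X < ε) ≤ K ε` for all `ε`, then `X⁻¹` has moments of all orders less than one. -/
theorem lintegral_inv_rpow_le {Ω : Type*} [MeasurableSpace Ω] (P : Measure Ω)
    [IsProbabilityMeasure P] {X : Ω → ℝ} (hX : Measurable X) (hX0 : ∀ ω, 0 ≤ X ω) {K : ℝ}
    (hK : 0 ≤ K) (htail : ∀ ε : ℝ, P {ω | X ω < ε} ≤ ENNReal.ofReal (K * ε)) {γ : ℝ}
    (hγ0 : 0 < γ) (hγ1 : γ < 1) :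
    ∫⁻ ω, (ENNReal.ofReal (X ω))⁻¹ ^ γ ∂P ≤ ENNReal.ofReal (1 + K * (γ / (1 - γ))) := by
  have hpos : ∀ᵐ ω ∂P, 0 < X ω := by
    rw [ae_iff, ← nonpos_iff_eq_zero]
    have hlim : Filter.Tendsto (fun ε : ℝ => ENNReal.ofReal (K * ε))
        (nhdsWithin 0 (Ioi 0)) (nhds 0) := by
      have hc : Continuous fun ε : ℝ => ENNReal.ofReal (K * ε) :=
        ENNReal.continuous_ofReal.comp (continuous_const.mul continuous_id)
      simpa using (hc.tendsto 0).mono_left nhdsWithin_le_nhds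
    refine ge_of_tendsto hlim ?_
    filter_upwards [self_mem_nhdsWithin] with ε hε
    exact (measure_mono fun ω hω => (not_lt.1 hω).trans_lt hε).trans (htail ε)
  have hcongr : ∫⁻ ω, (ENNReal.ofReal (X ω))⁻¹ ^ γ ∂P
      = ∫⁻ ω, ENNReal.ofReal ((X ω)⁻¹ ^ γ) ∂P := by
    refine lintegral_congr_ae ?_
    filter_upwards [hpos] with ω hω
    rw [← ENNReal.ofReal_inv_of_pos hω, ENNReal.ofReal_rpow_of_pos (inv_pos.2 hω)]
  -- Layer cake split at `t = 1`: probability at most one below, at most `K / t` above.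
  rw [hcongr, lintegral_rpow_eq_lintegral_meas_lt_mul P
    (.of_forall fun ω => inv_nonneg.2 (hX0 ω)) hX.inv.aemeasurable hγ0,
    ← Ioc_union_Ioi_eq_Ioi zero_le_one, lintegral_union measurableSet_Ioi
      (Ioc_disjoint_Ioi le_rfl)]
  have hI1 : ∫⁻ t in Ioc (0 : ℝ) 1, P {ω | t < (X ω)⁻¹} * ENNReal.ofReal (t ^ (γ - 1)) ≤
      ENNReal.ofReal (1 / γ) := by
    calc _ ≤ ∫⁻ t in Ioc (0 : ℝ) 1, ENNReal.ofReal (t ^ (γ - 1)) :=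
          lintegral_mono fun t => mul_le_of_le_one_left' prob_le_one
      _ = ENNReal.ofReal (∫ t in Ioc (0 : ℝ) 1, t ^ (γ - 1)) := by
          rw [ofReal_integral_eq_lintegral_ofReal]
          · exact (intervalIntegral.intervalIntegrable_rpow' (by linarith)).1
          · filter_upwards [ae_restrict_mem measurableSet_Ioc] with t ht
            exact Real.rpow_nonneg ht.1.le _
      _ = _ := by
          rw [← intervalIntegral.integral_of_le zero_le_one, integral_rpow (Or.inl (by linarith))]
          simp [hγ0.ne']
  have hI2 : ∫⁻ t in Ioi (1 : ℝ), P {ω | t < (X ω)⁻¹} * ENNReal.ofReal (t ^ (γ - 1)) ≤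
      ENNReal.ofReal (K / (1 - γ)) := by
    calc _ ≤ ∫⁻ t in Ioi (1 : ℝ), ENNReal.ofReal (K * t ^ (γ - 2)) := by
          refine setLIntegral_mono' measurableSet_Ioi fun t ht => ?_
          have ht0 : 0 < t := zero_lt_one.trans ht
          have h1 : P {ω | t < (X ω)⁻¹} ≤ ENNReal.ofReal (K * t⁻¹) := by
            refine (measure_mono fun ω hω => ?_).trans (htail t⁻¹)
            have hω : t < (X ω)⁻¹ := hω
            exact (lt_inv_comm₀ ht0 (inv_pos.1 (ht0.trans hω))).1 hω
          refine (mul_le_mul_left h1 _).trans (le_of_eq ?_)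
          rw [← ENNReal.ofReal_mul (by positivity), mul_assoc, ← Real.rpow_neg_one,
            ← Real.rpow_add ht0]
          congr 3
          ring
      _ = ENNReal.ofReal (∫ t in Ioi (1 : ℝ), K * t ^ (γ - 2)) := by
          rw [ofReal_integral_eq_lintegral_ofReal]
          · exact (integrableOn_Ioi_rpow_of_lt (by linarith) one_pos).const_mul K
          · filter_upwards [ae_restrict_mem measurableSet_Ioi] with t ht
            exact mul_nonneg hK (Real.rpow_nonneg (zero_lt_one.trans ht).le _)
      _ = _ := by
          rw [integral_const_mul, integral_Ioi_rpow_of_lt (by linarith) one_pos, Real.one_rpow]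
          congr 1
          rw [div_eq_mul_one_div K, ← neg_div_neg_eq]
          congr 2 <;> ring
  have h1γ : 0 < 1 - γ := by linarith
  calc _ ≤ ENNReal.ofReal γ * (ENNReal.ofReal (1 / γ) + ENNReal.ofReal (K / (1 - γ))) := by
        gcongr
    _ = _ := by
        rw [← ENNReal.ofReal_add (by positivity) (by positivity), ← ENNReal.ofReal_mul hγ0.le]
        congr 1
        field_simp

theorem one_le_condNumber {n m : ℕ} (A : Matrix (Fin n) (Fin m) ℝ) : 1 ≤ condNumber A := by
  rw [condNumber, ENNReal.one_le_inv]
  exact (ENNReal.ofReal_le_ofReal (Real.abs_cos_le_one _)).trans ENNReal.ofReal_one.le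

/-- Independence makes the joint law of the rows a product measure, and the rows are almost surely
unit vectors, as the min-max formula requires. -/
theorem lintegral_condNumber_rpow {Ω : Type*} [MeasurableSpace Ω] (P : Measure Ω)
    [IsProbabilityMeasure P] {n m : ℕ} [NeZero n] [NeZero m] (A : Ω → Matrix (Fin n) (Fin m) ℝ)
    (hA : IsUniformRandomMatrix A P) (γ : ℝ) :
    ∫⁻ ω, condNumber (A ω) ^ γ ∂P =
      ∫⁻ a, (ENNReal.ofReal |minMax a|)⁻¹ ^ γ ∂Measure.pi fun _ : Fin n => uniformSphere m := by
  have hmeas : ∀ i, AEMeasurable (fun ω => rowVec (A ω) i) P := fun i =>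
    (hA.hasLaw_row i).aemeasurable
  have hmap : P.map (fun ω => rowVec (A ω)) = Measure.pi fun _ : Fin n => uniformSphere m := by
    rw [(iIndepFun_iff_map_fun_eq_pi_map hmeas).1 hA.iIndepFun_row]
    simp_rw [(hA.hasLaw_row _).map_eq]
  have hunit : ∀ᵐ ω ∂P, ∀ i, ‖rowVec (A ω) i‖ = 1 := by
    refine ae_all_iff.2 fun i => ?_
    have := ae_norm_eq_one_uniformSphere m
    rw [← (hA.hasLaw_row i).map_eq] at this
    exact ae_of_ae_map (hmeas i) this
  rw [← hmap, lintegral_map' (measurable_inv_abs_minMax.pow_const γ).aemeasurable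
    (aemeasurable_pi_lambda _ hmeas)]
  refine lintegral_congr_ae ?_
  filter_upwards [hunit] with ω hω
  rw [condNumber, cos_theta_eq_minMax _ hω]

end LinearConic

theorem mainTheorem7 {Ω : Type*} [MeasurableSpace Ω] (P : Measure Ω) [IsProbabilityMeasure P]
    (n m : ℕ) (hm : 3 ≤ m) (hnm : m ≤ n)
    (A : Ω → Matrix (Fin n) (Fin m) ℝ) (hA : LinearConic.IsUniformRandomMatrix A P) :
    (∀ γ : ℝ, 1 ≤ γ → ∫⁻ ω, LinearConic.condNumber (A ω) ^ γ ∂P = ⊤) ∧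
    (∀ γ : ℝ, 0 < γ → γ < 1 →
      ∫⁻ ω, LinearConic.condNumber (A ω) ^ γ ∂P ≤
        ENNReal.ofReal
          (1 + (n.choose m : ℝ) * (2 * (m : ℝ) ^ (5 / 2 : ℝ)) * (γ / (1 - γ)))) := by
  obtain ⟨k, rfl⟩ : ∃ k, n = k + 1 := ⟨n - 1, by omega⟩
  have : NeZero m := ⟨by omega⟩
  refine ⟨fun γ hγ => ?_, fun γ hγ0 hγ1 => ?_⟩
  · have h1 : ∫⁻ ω, LinearConic.condNumber (A ω) ^ (1 : ℝ) ∂P = ⊤ := by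
      rw [LinearConic.lintegral_condNumber_rpow P A hA]
      simp_rw [ENNReal.rpow_one]
      exact LinearConic.lintegral_inv_abs_minMax (by omega) hnm
    rw [eq_top_iff, ← h1]
    exact lintegral_mono fun ω =>
      ENNReal.rpow_le_rpow_of_exponent_le (LinearConic.one_le_condNumber _) hγ
  · rw [LinearConic.lintegral_condNumber_rpow P A hA]
    exact LinearConic.lintegral_inv_rpow_le _ LinearConic.measurable_minMax.abs
      (fun a => abs_nonneg _) (by positivity)
      (LinearConic.pi_abs_minMax_lt_le (by omega) hnm) hγ0 hγ1
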